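/- Let $\mathbb{K}=\mathbb{R}$ or $\mathbb{C}$ and let $L^1$, $L^\infty$ be the Lebesgue spaces of $\mathbb{K}$-valued functions on $\mathbb{R}^n$ (functions equal almost everywhere being identified). For a measure $\mu$ on a subset of $\mathbb{R}$, a measurable $q:\mathbb{R}\to[1,\infty)$ and a non-negative function $F$, put $$\|F\|_{L^{q(\cdot)}(\mu)}=\inf\Big\{r>0:\int (F(t)/r)^{q(t)}\,d\mu(t)\le 1\Big\}\qquad(\inf\emptyset=\infty).$$ For a compatible couple of Banach spaces $(A_0,A_1)$, i.e. two Banach spaces continuously embedded in a common Hausdorff topological vector space, let $$K(t,f)=\inf\{\|f_0\|_{A_0}+t\|f_1\|_{A_1}: f=f_0+f_1,\ f_0\in A_0,\ f_1\in A_1\},\qquad t>0,$$ and, for $\theta\in(0,1)$, let $(A_0,A_1)_{\theta,q(\cdot)}$ be the set of all $f\in A_0+A_1$ with $$\|f\|_{(A_0,A_1)_{\theta,q(\cdot)}}=\big\|t^{-\theta}K(t,f)\big\|_{L^{q(\cdot)}((0,\infty),dt/t)}<\infty .$$ For a measurable function $f$ on $\mathbb{R}^n$ let $f^*(t)=\sup\{\lambda>0:|\{x:|f(x)|>\lambda\}|>t\}$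 (with $\sup\emptyset=0$) be its non-increasing rearrangement, and for measurable $p,q:\mathbb{R}\to[1,\infty)$ let $\mathcal{L}^{p(\cdot),q(\cdot)}(\mathbb{R}^n)$ be the variable exponent Lorentz space of all measurable $f$ with $$\|f\|_{\mathcal{L}^{p(\cdot),q(\cdot)}(\mathbb{R}^n)}=\big\|t^{\frac1{p(t)}-\frac1{q(t)}}f^*(t)\big\|_{L^{q(\cdot)}([0,\infty),dt)}<\infty .$$ **Theorem.** Let $\theta\in(0,1)$ and let $q:\mathbb{R}\to[1,\infty)$ be a measurable function which is log-Hölder continuous at the origin and at infinity, i.e. there are $q_\infty\in\mathbb{R}$ and $c_{\log}>0$ with $$|q(t)-q(0)|\le\frac{c_{\log}}{\log(e+1/|t|)},\qquad |q(t)-q_\infty|\le\frac{c_{\log}}{\log(e+|t|)}\qquad\text{for all }t$$ (the first for $t\ne0$), and suppose that $q(0)=q_\infty$. Let $p=\frac1{1-\theta}$ (a constant exponent). Then $$(L^1,L^\infty)_{\theta,q(\cdot)}=\mathcal{L}^{p,q(\cdot)}(\mathbb{R}^n)$$ with equivalent (quasi-)norms: the two sets coincide, and there are constants $c,C>0$ such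 that for all measurable $f$ on $\mathbb{R}^n$ $$c\,\|f\|_{\mathcal{L}^{p,q(\cdot)}(\mathbb{R}^n)}\le\|f\|_{(L^1,L^\infty)_{\theta,q(\cdot)}}\le C\,\|f\|_{\mathcal{L}^{p,q(\cdot)}(\mathbb{R}^n)},$$ where $K(t,f)=\infty$, and hence the middle term is $\infty$, if $f\notin L^1+L^\infty$. -/

import Mathlib

open MeasureTheory Set
open scoped ENNReal NNReal

noncomputable section

/-! ### Variable exponents on the line -/

/-- A variable exponent: a Lebesgue measurable function on `ℝ` with range in `[1, ∞)`. -/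
structure IsVariableExponent (q : ℝ → ℝ) : Prop where
  aemeasurable : AEMeasurable q volume
  one_le : ∀ t, 1 ≤ q t

/-- `g` is log-Hölder continuous at the origin.  (At `x = 0` the inequality just says `0 ≤ c`.) -/
def LogHolderAtZero (g : ℝ → ℝ) : Prop :=
  ∃ c : ℝ, 0 < c ∧ ∀ x : ℝ, |g x - g 0| ≤ c / Real.log (Real.exp 1 + 1 / |x|)

/-- `g` is log-Hölder continuous at infinity (satisfies the log-Hölder decay condition), with
limit value `gInf`. -/
def LogHolderAtInfty (g : ℝ → ℝ) (gInf : ℝ) : Prop :=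
  ∃ c : ℝ, 0 < c ∧ ∀ x : ℝ, |g x - gInf| ≤ c / Real.log (Real.exp 1 + |x|)

/-! ### Variable exponent Lebesgue norms -/

/-- The modular `∫ F(t)^{q(t)} dμ(t)` of a non-negative function `F`. -/
def varModular (q : ℝ → ℝ) (μ : Measure ℝ) (F : ℝ → ℝ≥0∞) : ℝ≥0∞ :=
  ∫⁻ t, F t ^ q t ∂μ

/-- The Luxemburg norm `inf {r > 0 : modular (F / r) ≤ 1}` of a non-negative function `F` in
`L^{q(·)}(μ)`; it is `∞` when there is no such `r`. -/
def luxemburgNorm (q : ℝ → ℝ) (μ : Measure ℝ) (F : ℝ → ℝ≥0∞) : ℝ≥0∞ :=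
  ⨅ (r : ℝ≥0) (_ : 0 < r ∧ varModular q μ (fun t => F t / r) ≤ 1), (r : ℝ≥0∞)

/-- The measure `dt / t` on `(0, ∞)`. -/
def dtOverT : Measure ℝ :=
  (volume.restrict (Ioi (0 : ℝ))).withDensity fun t => ENNReal.ofReal t⁻¹

/-! ### Real interpolation with variable exponent -/

/-- A compatible couple `(A₀, A₁)` of Banach spaces: both are linearly and injectively embedded
in a vector space `Z` which carries a Hausdorff vector space topology making the two embeddings
continuous. -/
structure CompatibleCouple (𝕜 A₀ A₁ Z : Type*) [RCLike 𝕜]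
    [NormedAddCommGroup A₀] [NormedSpace 𝕜 A₀] [CompleteSpace A₀]
    [NormedAddCommGroup A₁] [NormedSpace 𝕜 A₁] [CompleteSpace A₁]
    [AddCommGroup Z] [Module 𝕜 Z] where
  ι₀ : A₀ →ₗ[𝕜] Z
  ι₁ : A₁ →ₗ[𝕜] Z
  injective₀ : Function.Injective ι₀
  injective₁ : Function.Injective ι₁
  compatible : ∃ _ : TopologicalSpace Z,
    IsTopologicalAddGroup Z ∧ ContinuousSMul 𝕜 Z ∧ T2Space Z ∧ Continuous ι₀ ∧ Continuous ι₁

namespace CompatibleCouple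

variable {𝕜 A₀ A₁ Z : Type*} [RCLike 𝕜]
  [NormedAddCommGroup A₀] [NormedSpace 𝕜 A₀] [CompleteSpace A₀]
  [NormedAddCommGroup A₁] [NormedSpace 𝕜 A₁] [CompleteSpace A₁]
  [AddCommGroup Z] [Module 𝕜 Z]

/-- The sum `A₀ + A₁` inside `Z`. -/
def sum (A : CompatibleCouple 𝕜 A₀ A₁ Z) : Set Z :=
  {f | ∃ (f₀ : A₀) (f₁ : A₁), f = A.ι₀ f₀ + A.ι₁ f₁}

/-- Peetre's functional `K(t, f) = inf (‖f₀‖ + t ‖f₁‖)` over all decompositions `f = f₀ + f₁`;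
it is `∞` when `f` is not in `A₀ + A₁`. -/
def K (A : CompatibleCouple 𝕜 A₀ A₁ Z) (t : ℝ) (f : Z) : ℝ≥0∞ :=
  ⨅ (f₀ : A₀) (f₁ : A₁) (_ : f = A.ι₀ f₀ + A.ι₁ f₁), ‖f₀‖ₑ + ENNReal.ofReal t * ‖f₁‖ₑ

/-- The functional `‖ t^{-θ} K(t, f) ‖` in `L^{q(·)}((0, ∞), dt/t)`. -/
def interpNorm (A : CompatibleCouple 𝕜 A₀ A₁ Z) (θ : ℝ) (q : ℝ → ℝ) (f : Z) : ℝ≥0∞ :=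
  luxemburgNorm q dtOverT fun t => ENNReal.ofReal (t ^ (-θ)) * A.K t f

/-- The real interpolation space `(A₀, A₁)_{θ, q(·)}`. -/
def interpSpace (A : CompatibleCouple 𝕜 A₀ A₁ Z) (θ : ℝ) (q : ℝ → ℝ) : Set Z :=
  {f | f ∈ A.sum ∧ A.interpNorm θ q f < ∞}

end CompatibleCouple

/-! ### Variable exponent Lorentz spaces -/

/-- The distribution function `m_f(s) = |{x : |f x| > s}|`. -/
def distribFun {n : ℕ} {𝕜 : Type*} [RCLike 𝕜] (f : EuclideanSpace ℝ (Fin n) → 𝕜) (s : ℝ≥0) :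
    ℝ≥0∞ :=
  volume {x | s < ‖f x‖₊}

/-- The non-increasing rearrangement `f^*(t) = sup {s > 0 : m_f(s) > t}` (with `sup ∅ = 0`). -/
def rearrangement {n : ℕ} {𝕜 : Type*} [RCLike 𝕜] (f : EuclideanSpace ℝ (Fin n) → 𝕜) (t : ℝ) :
    ℝ≥0∞ :=
  ⨆ (s : ℝ≥0) (_ : 0 < s ∧ ENNReal.ofReal t < distribFun f s), (s : ℝ≥0∞)

/-- The functional `‖ t^{1/p(t) - 1/q(t)} f^*(t) ‖` in `L^{q(·)}([0, ∞))`. -/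
def lorentzNorm {n : ℕ} {𝕜 : Type*} [RCLike 𝕜] (p q : ℝ → ℝ)
    (f : EuclideanSpace ℝ (Fin n) → 𝕜) : ℝ≥0∞ :=
  luxemburgNorm q (volume.restrict (Ici (0 : ℝ)))
    fun t => ENNReal.ofReal (t ^ (1 / p t - 1 / q t)) * rearrangement f t

/-- The variable exponent Lorentz space `𝓛^{p(·), q(·)}(ℝⁿ)`, as a set of classes of measurable
functions modulo equality almost everywhere. -/
def lorentzSpace (n : ℕ) (𝕜 : Type*) [RCLike 𝕜] (p q : ℝ → ℝ) :
    Set (EuclideanSpace ℝ (Fin n) →ₘ[volume] 𝕜) :=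
  {f | lorentzNorm p q (f : EuclideanSpace ℝ (Fin n) → 𝕜) < ∞}

/-! ### The couple `(L¹, L^∞)` -/

/-- The inclusion of `L^r(ℝⁿ)` in the space of classes of measurable functions. -/
def lpInclusion (n : ℕ) (𝕜 : Type*) [RCLike 𝕜] (r : ℝ≥0∞) :
    Lp 𝕜 r (volume : Measure (EuclideanSpace ℝ (Fin n))) →ₗ[𝕜]
      (EuclideanSpace ℝ (Fin n) →ₘ[volume] 𝕜) where
  toFun f := f.1
  map_add' _ _ := rfl
  map_smul' _ _ := rfl

/-! The compatibility of the couple `(L¹, L^∞)`: the classes of measurable functions carry the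
Hausdorff vector topology of local convergence in measure, given by the group norm
`∫ min(1, |f|) (1 + |x|)^{-(n+1)} dx`. -/

theorem exists_vectorTopology {𝕜 A₀ A₁ Z : Type*} [RCLike 𝕜]
    [NormedAddCommGroup A₀] [NormedSpace 𝕜 A₀] [NormedAddCommGroup A₁] [NormedSpace 𝕜 A₁]
    [AddCommGroup Z] [Module 𝕜 Z] (ι₀ : A₀ →ₗ[𝕜] Z) (ι₁ : A₁ →ₗ[𝕜] Z)
    (g : AddGroupNorm Z) (C₀ C₁ : ℝ)
    (hg : ∀ (c : 𝕜) (z : Z), g (c • z) ≤ max 1 ‖c‖ * g z)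
    (hg' : ∀ z : Z, Filter.Tendsto (fun c : 𝕜 => g (c • z)) (nhds 0) (nhds 0))
    (h₀ : ∀ a, g (ι₀ a) ≤ C₀ * ‖a‖) (h₁ : ∀ a, g (ι₁ a) ≤ C₁ * ‖a‖) :
    ∃ _ : TopologicalSpace Z,
      IsTopologicalAddGroup Z ∧ ContinuousSMul 𝕜 Z ∧ T2Space Z ∧
        Continuous ι₀ ∧ Continuous ι₁ := by
  let _ : NormedAddCommGroup Z := g.toNormedAddCommGroup
  have hn : ∀ z : Z, ‖z‖ = g z := fun _ => rfl
  refine ⟨inferInstance, inferInstance, ?_, inferInstance, ?_, ?_⟩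
  · refine ContinuousSMul.of_nhds_zero ?_ ?_ ?_
    · rw [← nhds_prod_eq]
      refine squeeze_zero_norm (a := fun p : 𝕜 × Z => max 1 ‖p.1‖ * ‖p.2‖) (fun p => hg p.1 p.2) ?_
      have : Continuous fun p : 𝕜 × Z => max 1 ‖p.1‖ * ‖p.2‖ := by fun_prop
      simpa using this.tendsto (0, 0)
    · intro z
      exact tendsto_zero_iff_norm_tendsto_zero.2 (hg' z)
    · intro c
      refine squeeze_zero_norm (a := fun z : Z => max 1 ‖c‖ * ‖z‖) (fun z => hg c z) ?_
      have : Continuous fun z : Z => max 1 ‖c‖ * ‖z‖ := by fun_prop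
      simpa using this.tendsto 0
  · exact AddMonoidHomClass.continuous_of_bound ι₀ C₀ h₀
  · exact AddMonoidHomClass.continuous_of_bound ι₁ C₁ h₁

theorem integrable_weight (n : ℕ) :
    Integrable (fun x : EuclideanSpace ℝ (Fin n) => (1 + ‖x‖) ^ (-((n : ℝ) + 1))) volume :=
  integrable_one_add_norm (by simp)

theorem integrable_min_weight {n : ℕ} {𝕜 : Type*} [RCLike 𝕜]
    (f : EuclideanSpace ℝ (Fin n) →ₘ[volume] 𝕜) :
    Integrable (fun x => min 1 ‖f x‖ * (1 + ‖x‖) ^ (-((n : ℝ) + 1))) volume := by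
  refine (integrable_weight n).mono' ?_ (Filter.Eventually.of_forall fun x => ?_)
  · exact (aestronglyMeasurable_const.inf f.aestronglyMeasurable.norm).mul
      (integrable_weight n).aestronglyMeasurable
  · have h1 : (0 : ℝ) ≤ (1 + ‖x‖) ^ (-((n : ℝ) + 1)) := by positivity
    have h2 : (0 : ℝ) ≤ min 1 ‖f x‖ := by positivity
    rw [Real.norm_of_nonneg (by positivity)]
    exact mul_le_of_le_one_left h1 (min_le_left _ _)

/-- The group norm `∫ min(1, |f|) (1 + |x|)^{-(n+1)} dx`. -/
def measureNorm (n : ℕ) (𝕜 : Type*) [RCLike 𝕜] :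
    AddGroupNorm (EuclideanSpace ℝ (Fin n) →ₘ[volume] 𝕜) where
  toFun f := ∫ x, min 1 ‖f x‖ * (1 + ‖x‖) ^ (-((n : ℝ) + 1))
  map_zero' := by
    refine integral_eq_zero_of_ae ?_
    filter_upwards [AEEqFun.coeFn_zero (α := EuclideanSpace ℝ (Fin n)) (μ := volume) (β := 𝕜)]
      with x hx
    simp [hx]
  add_le' f g := by
    rw [← integral_add (integrable_min_weight f) (integrable_min_weight g)]
    refine integral_mono_ae (integrable_min_weight _)
      ((integrable_min_weight f).add (integrable_min_weight g)) ?_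
    filter_upwards [AEEqFun.coeFn_add f g] with x hx
    simp only [hx, Pi.add_apply, ← add_mul]
    refine mul_le_mul_of_nonneg_right ?_ (by positivity)
    have h := norm_add_le (f x) (g x)
    rcases le_total 1 ‖f x‖ with h3 | h3
    · rw [min_eq_left h3]
      exact (min_le_left _ _).trans (by simp)
    · rcases le_total 1 ‖g x‖ with h4 | h4
      · rw [min_eq_left h4]
        exact (min_le_left _ _).trans (by simp)
      · rw [min_eq_right h3, min_eq_right h4]
        exact (min_le_right _ _).trans h
  neg' f := by
    refine integral_congr_ae ?_
    filter_upwards [AEEqFun.coeFn_neg f] with x hx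
    simp [hx]
  eq_zero_of_map_eq_zero' f hf := by
    have hpos : ∀ x : EuclideanSpace ℝ (Fin n), (0 : ℝ) < (1 + ‖x‖) ^ (-((n : ℝ) + 1)) :=
      fun x => by positivity
    have h := (integral_eq_zero_iff_of_nonneg
      (fun x => mul_nonneg (by positivity) (hpos x).le) (integrable_min_weight f)).1 hf
    refine AEEqFun.ext ?_
    filter_upwards [h, AEEqFun.coeFn_zero (α := EuclideanSpace ℝ (Fin n)) (μ := volume) (β := 𝕜)]
      with x hx h0
    have h3 : min 1 ‖f x‖ = 0 := by
      rcases mul_eq_zero.1 hx with h | h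
      · exact h
      · exact absurd h (hpos x).ne'
    have h4 : ‖f x‖ = 0 := by
      rcases min_choice 1 ‖f x‖ with h | h <;> rw [h] at h3
      · norm_num at h3
      · exact h3
    rw [h0, norm_eq_zero.1 h4]
    rfl

theorem measureNorm_apply {n : ℕ} {𝕜 : Type*} [RCLike 𝕜]
    (f : EuclideanSpace ℝ (Fin n) →ₘ[volume] 𝕜) :
    measureNorm n 𝕜 f = ∫ x, min 1 ‖f x‖ * (1 + ‖x‖) ^ (-((n : ℝ) + 1)) := rfl

theorem measureNorm_smul_le {n : ℕ} {𝕜 : Type*} [RCLike 𝕜] (c : 𝕜)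
    (f : EuclideanSpace ℝ (Fin n) →ₘ[volume] 𝕜) :
    measureNorm n 𝕜 (c • f) ≤ max 1 ‖c‖ * measureNorm n 𝕜 f := by
  rw [measureNorm_apply, measureNorm_apply, ← integral_const_mul]
  refine integral_mono_ae (integrable_min_weight _) ((integrable_min_weight f).const_mul _) ?_
  filter_upwards [AEEqFun.coeFn_smul c f] with x hx
  simp only [hx, Pi.smul_apply, norm_smul, ← mul_assoc]
  refine mul_le_mul_of_nonneg_right ?_ (by positivity)
  rcases le_total 1 ‖f x‖ with h | h
  · rw [min_eq_left h, mul_one]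
    exact (min_le_left _ _).trans (le_max_left _ _)
  · rw [min_eq_right h]
    exact (min_le_right _ _).trans (mul_le_mul_of_nonneg_right (le_max_right _ _) (norm_nonneg _))

theorem tendsto_measureNorm_smul {n : ℕ} {𝕜 : Type*} [RCLike 𝕜]
    (f : EuclideanSpace ℝ (Fin n) →ₘ[volume] 𝕜) :
    Filter.Tendsto (fun c : 𝕜 => measureNorm n 𝕜 (c • f)) (nhds 0) (nhds 0) := by
  have heq : (fun c : 𝕜 => measureNorm n 𝕜 (c • f)) =
      fun c => ∫ x, min 1 (‖c‖ * ‖f x‖) * (1 + ‖x‖) ^ (-((n : ℝ) + 1)) := by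
    funext c
    refine integral_congr_ae ?_
    filter_upwards [AEEqFun.coeFn_smul c f] with x hx
    simp only [hx, Pi.smul_apply, norm_smul]
  rw [heq]
  have h := tendsto_integral_filter_of_dominated_convergence (μ := volume) (l := nhds (0 : 𝕜))
    (F := fun (c : 𝕜) (x : EuclideanSpace ℝ (Fin n)) =>
      min 1 (‖c‖ * ‖f x‖) * (1 + ‖x‖) ^ (-((n : ℝ) + 1)))
    (f := fun _ => (0 : ℝ))
    (fun x : EuclideanSpace ℝ (Fin n) => (1 + ‖x‖) ^ (-((n : ℝ) + 1))) ?_ ?_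
    (integrable_weight n) ?_
  · simpa using h
  · refine Filter.Eventually.of_forall fun c => ?_
    exact (aestronglyMeasurable_const.inf (f.aestronglyMeasurable.norm.const_mul _)).mul
      (integrable_weight n).aestronglyMeasurable
  · refine Filter.Eventually.of_forall fun c => Filter.Eventually.of_forall fun x => ?_
    have h1 : (0 : ℝ) ≤ (1 + ‖x‖) ^ (-((n : ℝ) + 1)) := by positivity
    have h2 : (0 : ℝ) ≤ min 1 (‖c‖ * ‖f x‖) := by positivity
    rw [Real.norm_of_nonneg (by positivity)]
    exact mul_le_of_le_one_left h1 (min_le_left _ _)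
  · refine Filter.Eventually.of_forall fun x => ?_
    have : Continuous fun c : 𝕜 => min 1 (‖c‖ * ‖f x‖) * (1 + ‖x‖) ^ (-((n : ℝ) + 1)) := by
      fun_prop
    simpa using this.tendsto 0

theorem measureNorm_one_le {n : ℕ} {𝕜 : Type*} [RCLike 𝕜]
    (f : Lp 𝕜 1 (volume : Measure (EuclideanSpace ℝ (Fin n)))) :
    measureNorm n 𝕜 (lpInclusion n 𝕜 1 f) ≤ 1 * ‖f‖ := by
  rw [one_mul, L1.norm_eq_integral_norm, measureNorm_apply]
  refine integral_mono (integrable_min_weight _) (L1.integrable_coeFn f).norm fun x => ?_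
  have h1 : (1 + ‖x‖) ^ (-((n : ℝ) + 1)) ≤ 1 :=
    Real.rpow_le_one_of_one_le_of_nonpos (by simp) (by linarith [n.cast_nonneg (α := ℝ)])
  exact (mul_le_of_le_one_right (by positivity) h1).trans (min_le_right _ _)

theorem measureNorm_top_le {n : ℕ} {𝕜 : Type*} [RCLike 𝕜]
    (f : Lp 𝕜 ∞ (volume : Measure (EuclideanSpace ℝ (Fin n)))) :
    measureNorm n 𝕜 (lpInclusion n 𝕜 ∞ f) ≤
      (∫ x : EuclideanSpace ℝ (Fin n), (1 + ‖x‖) ^ (-((n : ℝ) + 1))) * ‖f‖ := by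
  rw [measureNorm_apply, ← integral_mul_const]
  refine integral_mono_ae (integrable_min_weight _) ((integrable_weight n).mul_const _) ?_
  have hae : ∀ᵐ x : EuclideanSpace ℝ (Fin n), ‖f x‖ ≤ ‖f‖ := by
    filter_upwards [ae_le_eLpNormEssSup (f := f) (μ := volume)] with x hx
    rw [Lp.norm_def, eLpNorm_exponent_top, ← toReal_enorm]
    refine ENNReal.toReal_mono ?_ hx
    rw [← eLpNorm_exponent_top]
    exact Lp.eLpNorm_ne_top f
  filter_upwards [hae] with x hx
  rw [mul_comm]
  exact mul_le_mul_of_nonneg_left ((min_le_right _ _).trans hx) (by positivity)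

/-- The compatible couple `(L¹(ℝⁿ), L^∞(ℝⁿ))`, inside the space of classes of measurable
functions. -/
def coupleL1LInfty (n : ℕ) (𝕜 : Type*) [RCLike 𝕜] :
    CompatibleCouple 𝕜
      (Lp 𝕜 1 (volume : Measure (EuclideanSpace ℝ (Fin n))))
      (Lp 𝕜 ∞ (volume : Measure (EuclideanSpace ℝ (Fin n))))
      (EuclideanSpace ℝ (Fin n) →ₘ[volume] 𝕜) where
  ι₀ := lpInclusion n 𝕜 1
  ι₁ := lpInclusion n 𝕜 ∞
  injective₀ := Subtype.val_injective
  injective₁ := Subtype.val_injective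
  compatible := exists_vectorTopology _ _ (measureNorm n 𝕜) _ _ measureNorm_smul_le
    tendsto_measureNorm_smul measureNorm_one_le measureNorm_top_le

end

/-! Since `1/p = 1 - θ`, moving the factor `t^{-1/q(t)}` into the measure turns the Lorentz norm
into the norm of `t^{1-θ} f^*(t)` in `L^{q(·)}(dt/t)`. It is compared with that of `t^{-θ} K(t,f)`
through `t f^*(t) ≤ K(t,f) ≤ 2 ∫₀ᵗ f^*` (`mul_rearrangement_le_K`,
`K_le_two_mul_lintegral_rearrangement`). The left bound gives one inequality with constant 1; the
right one reduces the other to Hardy's inequality in `L^{q(·)}(dt/t)` for non-increasing functions,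
`exists_varModular_hardy_le_one`.

For a constant exponent, Hardy's inequality is Jensen plus Tonelli. To pass to `q(·)`, normalise the
modular to be at most 1. Monotonicity then bounds `t^{1-θ} φ(t)` by 4
(`rpow_mul_le_four_of_varModular_le_one`), and for functions bounded by 1 the modulars with
exponents `q(·)` and `q(0)` control each other up to a factor and a finite additive error
(`varModular_le_of_forall_rpow_le`). This is where log-Hölder continuity and `q(0) = q_∞` enter: one
constant exponent serves at both ends. Averages of functions bounded by 1 stay bounded by 1, so the
comparison can be used before and after the constant-exponent inequality. -/

/-! ### Comparing modulars with variable and constant exponents -/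

/-- If `x ≤ w`, then `x ^ a ≤ x ≤ w` because `a ≥ 1`. If `x > w`, changing the exponent costs `x ^
(a - b)`, at most `exp (|a - b| log (1/w))`. -/
theorem ENNReal.rpow_le_exp_mul_rpow_add {a b c w : ℝ} (ha : 1 ≤ a) (hw : 0 < w)
    (hab : |a - b| * Real.log w⁻¹ ≤ c) {x : ℝ≥0∞} (hx : x ≤ 1) :
    x ^ a ≤ ENNReal.ofReal (Real.exp c) * x ^ b + ENNReal.ofReal w := by
  rcases le_or_gt x (ENNReal.ofReal w) with h | h
  · calc x ^ a ≤ x ^ (1 : ℝ) := ENNReal.rpow_le_rpow_of_exponent_ge hx ha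
      _ = x := ENNReal.rpow_one x
      _ ≤ _ := h.trans le_add_self
  · refine le_trans ?_ le_self_add
    have hx0 : x ≠ 0 := (bot_le.trans_lt h).ne'
    have hxt : x ≠ ∞ := (hx.trans_lt ENNReal.one_lt_top).ne
    have hlt : w < x.toReal := (ENNReal.ofReal_lt_iff_lt_toReal hw.le hxt).1 h
    have hx1 : x.toReal ≤ 1 := ENNReal.toReal_le_of_le_ofReal zero_le_one (by simpa using hx)
    have hxp : 0 < x.toReal := hw.trans hlt
    have key : x ^ (a - b) ≤ ENNReal.ofReal (Real.exp c) := by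
      rw [← ENNReal.ofReal_toReal hxt, ENNReal.ofReal_rpow_of_pos hxp]
      refine ENNReal.ofReal_le_ofReal ?_
      rw [Real.rpow_def_of_pos hxp]
      refine Real.exp_le_exp.2 (le_trans ?_ hab)
      have h1 : Real.log x.toReal ≤ 0 := Real.log_nonpos hxp.le hx1
      have h2 : Real.log w ≤ Real.log x.toReal := Real.log_le_log hw hlt.le
      rw [Real.log_inv]
      nlinarith [abs_nonneg (a - b), neg_abs_le (a - b)]
    calc x ^ a = x ^ (a - b) * x ^ b := by
          rw [← ENNReal.rpow_add _ _ hx0 hxt, sub_add_cancel]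
      _ ≤ _ := by gcongr

/-- The weight `min t t⁻¹` is small only near the origin and infinity, and there its logarithm is
dominated by the corresponding log-Hölder denominator. -/
theorem abs_mul_log_inv_min_le {a b c t : ℝ} (ht : 0 < t)
    (h0 : |a - b| ≤ c / Real.log (Real.exp 1 + 1 / |t|))
    (hInf : |a - b| ≤ c / Real.log (Real.exp 1 + |t|)) :
    |a - b| * Real.log (min t t⁻¹)⁻¹ ≤ c := by
  have aux : ∀ s : ℝ, 0 < s → |a - b| ≤ c / Real.log (Real.exp 1 + s) →
      |a - b| * Real.log s ≤ c := by
    intro s hs h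
    have he : 1 < Real.exp 1 + s := by linarith [Real.add_one_le_exp (1 : ℝ)]
    have hl : 0 < Real.log (Real.exp 1 + s) := Real.log_pos he
    rw [le_div_iff₀ hl] at h
    refine le_trans ?_ h
    gcongr
    linarith [Real.exp_pos 1]
  rw [abs_of_pos ht] at h0 hInf
  rcases min_choice t t⁻¹ with h | h <;> rw [h]
  · exact aux _ (inv_pos.2 ht) (by simpa using h0)
  · rw [inv_inv]
    exact aux _ ht hInf

theorem lintegral_dtOverT (F : ℝ → ℝ≥0∞) :
    ∫⁻ t, F t ∂dtOverT = ∫⁻ t in Ioi (0 : ℝ), ENNReal.ofReal t⁻¹ * F t := by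
  rw [dtOverT, lintegral_withDensity_eq_lintegral_mul_non_measurable _ (by fun_prop)
    (Filter.Eventually.of_forall fun _ => ENNReal.ofReal_lt_top)]
  rfl

theorem ae_dtOverT_pos : ∀ᵐ t ∂dtOverT, 0 < t :=
  (withDensity_absolutelyContinuous _ _).ae_le (ae_restrict_mem measurableSet_Ioi)

theorem lintegral_min_inv_dtOverT_lt_top :
    ∫⁻ t, ENNReal.ofReal (min t t⁻¹) ∂dtOverT < ∞ := by
  rw [lintegral_dtOverT, ← Ioc_union_Ioi_eq_Ioi zero_le_one]
  refine (lintegral_union_le _ _ _).trans_lt (ENNReal.add_lt_top.2 ⟨?_, ?_⟩)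
  · calc _ ≤ ∫⁻ _ in Ioc (0 : ℝ) 1, 1 := by
          refine setLIntegral_mono' measurableSet_Ioc fun t ht => ?_
          rw [← ENNReal.ofReal_mul (by simpa using ht.1.le), ← ENNReal.ofReal_one]
          refine ENNReal.ofReal_le_ofReal ?_
          calc t⁻¹ * min t t⁻¹ ≤ t⁻¹ * t := by
                gcongr
                · simpa using ht.1.le
                · exact min_le_left _ _
            _ = 1 := inv_mul_cancel₀ ht.1.ne'
      _ < ∞ := by simp
  · calc _ ≤ ∫⁻ t in Ioi (1 : ℝ), ENNReal.ofReal (t ^ (-2 : ℝ)) := by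
          refine setLIntegral_mono' measurableSet_Ioi fun t ht => ?_
          have ht0 : (0 : ℝ) < t := zero_lt_one.trans ht
          rw [← ENNReal.ofReal_mul (by positivity)]
          refine ENNReal.ofReal_le_ofReal ?_
          calc t⁻¹ * min t t⁻¹ ≤ t⁻¹ * t⁻¹ := by
                gcongr
                exact min_le_right _ _
            _ = t ^ (-2 : ℝ) := by
              rw [Real.rpow_neg ht0.le, Real.rpow_ofNat, sq, mul_inv]
      _ < ∞ := (integrableOn_Ioi_rpow_of_lt (by norm_num) zero_lt_one).lintegral_lt_top

theorem varModular_le_of_forall_rpow_le {a b : ℝ → ℝ} {c : ℝ} (ha : ∀ t, 1 ≤ a t)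
    (hab : ∀ t, 0 < t → |a t - b t| * Real.log (min t t⁻¹)⁻¹ ≤ c) {F : ℝ → ℝ≥0∞}
    (hF : ∀ t, 0 < t → F t ≤ 1) :
    varModular a dtOverT F ≤ ENNReal.ofReal (Real.exp c) * varModular b dtOverT F +
      ∫⁻ t, ENNReal.ofReal (min t t⁻¹) ∂dtOverT := by
  unfold varModular
  -- Only the weight has to be measurable here; `F` and the exponents are arbitrary.
  rw [← lintegral_const_mul' _ _ ENNReal.ofReal_ne_top, ← lintegral_add_right _ (by fun_prop)]
  refine lintegral_mono_ae ?_
  filter_upwards [ae_dtOverT_pos] with t ht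
  exact ENNReal.rpow_le_exp_mul_rpow_add (ha t) (lt_min ht (inv_pos.2 ht)) (hab t ht) (hF t ht)

theorem varModular_mono {q : ℝ → ℝ} (hq : ∀ t, 1 ≤ q t) {F G : ℝ → ℝ≥0∞}
    (h : ∀ t, 0 < t → F t ≤ G t) : varModular q dtOverT F ≤ varModular q dtOverT G := by
  refine lintegral_mono_ae ?_
  filter_upwards [ae_dtOverT_pos] with t ht
  exact ENNReal.rpow_le_rpow (h t ht) (zero_le_one.trans (hq t))

/-- Since `B⁻¹ ^ q ≤ B⁻¹` for `q ≥ 1`, a modular bounded by `B` drops to at most 1 after division by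
`B`; additive errors are absorbed into a norm constant in this way. -/
theorem varModular_div_le {q : ℝ → ℝ} (hq : ∀ t, 1 ≤ q t) (μ : Measure ℝ) {B : ℝ≥0}
    (hB : 1 ≤ B) (F : ℝ → ℝ≥0∞) :
    varModular q μ (fun t => F t / B) ≤ varModular q μ F / B := by
  have hB0 : (B : ℝ≥0∞) ≠ 0 := by
    simpa using (zero_lt_one.trans_le hB).ne'
  unfold varModular
  rw [ENNReal.div_eq_inv_mul, ← lintegral_const_mul' _ _ (ENNReal.inv_ne_top.2 hB0)]
  refine lintegral_mono fun t => ?_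
  simp only
  rw [ENNReal.div_eq_inv_mul, ENNReal.mul_rpow_of_nonneg _ _ (zero_le_one.trans (hq t))]
  gcongr
  calc (B : ℝ≥0∞)⁻¹ ^ q t ≤ (B : ℝ≥0∞)⁻¹ ^ (1 : ℝ) :=
        ENNReal.rpow_le_rpow_of_exponent_ge (ENNReal.inv_le_one.2 (by exact_mod_cast hB)) (hq t)
    _ = _ := ENNReal.rpow_one _

theorem luxemburgNorm_le_mul {q : ℝ → ℝ} {μ ν : Measure ℝ} {F G : ℝ → ℝ≥0∞} {C : ℝ≥0}
    (hC : 0 < C)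
    (h : ∀ r : ℝ≥0, 0 < r → varModular q ν (fun t => G t / r) ≤ 1 →
      varModular q μ (fun t => F t / (C * r : ℝ≥0)) ≤ 1) :
    luxemburgNorm q μ F ≤ C * luxemburgNorm q ν G := by
  unfold luxemburgNorm
  have hC0 : (C : ℝ≥0∞) ≠ 0 := by simpa using hC.ne'
  rw [ENNReal.mul_iInf_of_ne hC0 ENNReal.coe_ne_top]
  refine le_iInf fun r => ?_
  rw [ENNReal.mul_iInf_of_ne hC0 ENNReal.coe_ne_top]
  refine le_iInf fun hr => ?_
  refine (iInf₂_le (C * r) ⟨mul_pos hC hr.1, h r hr.1 hr.2⟩).trans ?_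
  simp

/-! ### Hardy's inequality -/

theorem rpow_lintegral_le_lintegral_rpow {α : Type*} [MeasurableSpace α] (ν : Measure α)
    [IsProbabilityMeasure ν] {g : α → ℝ≥0∞} (hg : Measurable g) {p : ℝ} (hp : 1 ≤ p) :
    (∫⁻ s, g s ∂ν) ^ p ≤ ∫⁻ s, g s ^ p ∂ν := by
  have hp0 : 0 < p := zero_lt_one.trans_le hp
  have h := eLpNorm'_le_eLpNorm'_of_exponent_le zero_lt_one hp ν hg.aestronglyMeasurable
  simp only [eLpNorm', enorm_eq_self, ENNReal.rpow_one, one_div, inv_one] at h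
  calc _ ≤ ((∫⁻ s, g s ^ p ∂ν) ^ p⁻¹) ^ p := ENNReal.rpow_le_rpow h hp0.le
    _ = _ := ENNReal.rpow_inv_rpow hp0.ne' _

theorem lintegral_Ioc_rpow_sub_one {θ t : ℝ} (hθ : 0 < θ) (ht : 0 < t) :
    ∫⁻ s in Ioc 0 t, ENNReal.ofReal (θ * t ^ (-θ) * s ^ (θ - 1)) = 1 := by
  rw [← ofReal_integral_eq_lintegral_ofReal]
  · rw [← intervalIntegral.integral_of_le ht.le, intervalIntegral.integral_const_mul,
      integral_rpow (Or.inl (by linarith)), sub_add_cancel, Real.zero_rpow hθ.ne', sub_zero,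
      Real.rpow_neg ht.le]
    have := (Real.rpow_pos_of_pos ht θ).ne'
    field_simp
    simp
  · exact ((intervalIntegral.intervalIntegrable_rpow' (by linarith)).1).const_mul _
  · filter_upwards [ae_restrict_mem measurableSet_Ioc] with s hs
    have := hs.1
    positivity

theorem lintegral_Ioi_rpow_neg_sub_one {θ s : ℝ} (hθ : 0 < θ) (hs : 0 < s) :
    ∫⁻ t in Ioi s, ENNReal.ofReal (θ * t ^ (-θ - 1)) = ENNReal.ofReal (s ^ (-θ)) := by
  rw [← ofReal_integral_eq_lintegral_ofReal]
  · rw [integral_const_mul, integral_Ioi_rpow_of_lt (by linarith) hs]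
    congr 1
    rw [sub_add_cancel]
    field_simp
  · exact (integrableOn_Ioi_rpow_of_lt (by linarith) hs).const_mul _
  · filter_upwards [ae_restrict_mem measurableSet_Ioi] with t ht
    have : 0 < t := hs.trans ht
    positivity

/-- The weighted average `θ t^{-θ} ∫₀ᵗ s^{θ - 1} g(s) ds`. -/
noncomputable def hardyAverage (θ : ℝ) (g : ℝ → ℝ≥0∞) (t : ℝ) : ℝ≥0∞ :=
  ∫⁻ s in Ioc 0 t, ENNReal.ofReal (θ * t ^ (-θ) * s ^ (θ - 1)) * g s

theorem hardyAverage_le_one {θ t : ℝ} (hθ : 0 < θ) (ht : 0 < t) {g : ℝ → ℝ≥0∞}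
    (hg : ∀ s, 0 < s → g s ≤ 1) : hardyAverage θ g t ≤ 1 := by
  rw [← lintegral_Ioc_rpow_sub_one hθ ht]
  exact setLIntegral_mono' measurableSet_Ioc fun s hs => mul_le_of_le_one_right' (hg s hs.1)

theorem hardyAverage_rpow_le {θ t p : ℝ} (hθ : 0 < θ) (ht : 0 < t) (hp : 1 ≤ p) {g : ℝ → ℝ≥0∞}
    (hg : Measurable g) : hardyAverage θ g t ^ p ≤ hardyAverage θ (fun s => g s ^ p) t := by
  have hm : Measurable fun s : ℝ => ENNReal.ofReal (θ * t ^ (-θ) * s ^ (θ - 1)) := by fun_prop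
  have hprob : IsProbabilityMeasure ((volume.restrict (Ioc 0 t)).withDensity
      fun s : ℝ => ENNReal.ofReal (θ * t ^ (-θ) * s ^ (θ - 1))) :=
    ⟨by rw [withDensity_apply _ MeasurableSet.univ, setLIntegral_univ,
      lintegral_Ioc_rpow_sub_one hθ ht]⟩
  have h := rpow_lintegral_le_lintegral_rpow ((volume.restrict (Ioc 0 t)).withDensity
      fun s : ℝ => ENNReal.ofReal (θ * t ^ (-θ) * s ^ (θ - 1))) hg hp
  rwa [lintegral_withDensity_eq_lintegral_mul _ hm hg,
    lintegral_withDensity_eq_lintegral_mul _ hm (hg.pow_const p)] at h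

/-- By Tonelli: with respect to `dt/t` and `ds/s`, the kernel `θ (s/t)^θ` on `s ≤ t` has mass one in
each variable. -/
theorem lintegral_hardyAverage {θ : ℝ} (hθ : 0 < θ) {g : ℝ → ℝ≥0∞} (hg : Measurable g) :
    ∫⁻ t, hardyAverage θ g t ∂dtOverT = ∫⁻ t, g t ∂dtOverT := by
  have hS : MeasurableSet {z : ℝ × ℝ | z.2 ≤ z.1} := measurableSet_le measurable_snd measurable_fst
  let k : ℝ → ℝ → ℝ≥0∞ := fun t s => {z : ℝ × ℝ | z.2 ≤ z.1}.indicator (fun z =>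
    ENNReal.ofReal z.1⁻¹ * (ENNReal.ofReal (θ * z.1 ^ (-θ) * z.2 ^ (θ - 1)) * g z.2)) (t, s)
  have hk : Measurable (Function.uncurry k) := by
    refine Measurable.indicator ?_ hS
    fun_prop
  calc ∫⁻ t, hardyAverage θ g t ∂dtOverT
      = ∫⁻ t in Ioi (0 : ℝ), ∫⁻ s in Ioi (0 : ℝ), k t s := by
        rw [lintegral_dtOverT]
        refine setLIntegral_congr_fun measurableSet_Ioi fun t ht => ?_
        rw [hardyAverage, ← lintegral_const_mul' _ _ ENNReal.ofReal_ne_top, ← Ioi_inter_Iic,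
          inter_comm, ← Measure.restrict_restrict measurableSet_Iic,
          ← lintegral_indicator measurableSet_Iic]
        refine lintegral_congr fun s => ?_
        by_cases h : s ≤ t <;> simp [k, h]
    _ = ∫⁻ s in Ioi (0 : ℝ), ∫⁻ t in Ioi (0 : ℝ), k t s :=
        lintegral_lintegral_swap hk.aemeasurable
    _ = ∫⁻ s, g s ∂dtOverT := by
        rw [lintegral_dtOverT]
        refine setLIntegral_congr_fun measurableSet_Ioi fun s hs => ?_
        have hs : 0 < s := hs
        calc ∫⁻ t in Ioi (0 : ℝ), k t s
            = ∫⁻ t in Ici s, ENNReal.ofReal t⁻¹ *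
                (ENNReal.ofReal (θ * t ^ (-θ) * s ^ (θ - 1)) * g s) := by
              have : Ici s = Ici s ∩ Ioi 0 := by
                ext x
                simp only [mem_Ici, mem_inter_iff, mem_Ioi]
                exact ⟨fun h => ⟨h, hs.trans_le h⟩, fun h => h.1⟩
              rw [this, ← Measure.restrict_restrict measurableSet_Ici,
                ← lintegral_indicator measurableSet_Ici]
              refine lintegral_congr fun t => ?_
              by_cases h : s ≤ t <;> simp [k, h]
          _ = ∫⁻ t in Ioi s, ENNReal.ofReal (θ * t ^ (-θ - 1)) *
                (ENNReal.ofReal (s ^ (θ - 1)) * g s) := by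
              rw [← setLIntegral_congr Ioi_ae_eq_Ici]
              refine setLIntegral_congr_fun measurableSet_Ioi fun t ht => ?_
              have ht : 0 < t := hs.trans ht
              rw [← mul_assoc, ← mul_assoc, ← ENNReal.ofReal_mul (by positivity),
                ← ENNReal.ofReal_mul (by positivity), Real.rpow_sub_one ht.ne']
              congr 2
              ring
          _ = ENNReal.ofReal s⁻¹ * g s := by
              rw [lintegral_mul_const _ (by fun_prop), lintegral_Ioi_rpow_neg_sub_one hθ hs,
                ← mul_assoc, ← ENNReal.ofReal_mul (by positivity), ← Real.rpow_add hs]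
              congr 2
              rw [← Real.rpow_neg_one]
              congr 1
              ring

/-- Hardy's inequality for a constant exponent: Jensen moves the power inside the average, and
averaging preserves the integral, so the constant is 1. -/
theorem lintegral_hardyAverage_rpow_le {θ p : ℝ} (hθ : 0 < θ) (hp : 1 ≤ p) {g : ℝ → ℝ≥0∞}
    (hg : Measurable g) :
    ∫⁻ t, hardyAverage θ g t ^ p ∂dtOverT ≤ ∫⁻ t, g t ^ p ∂dtOverT := by
  rw [← lintegral_hardyAverage hθ (hg.pow_const p)]
  refine lintegral_mono_ae ?_
  filter_upwards [ae_dtOverT_pos] with t ht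
  exact hardyAverage_rpow_le hθ ht hp hg

/-- A value `x > 4` at `t` forces values at least `x / 2 ≥ 1` on `(t/2, t]`, where raising to `q(s)
≥ 1` does not decrease them. This interval has `ds/s`-measure at least `1/2`, so the modular would
be at least `x / 4 > 1`. -/
theorem rpow_mul_le_four_of_varModular_le_one {q : ℝ → ℝ} (hq : ∀ t, 1 ≤ q t) {θ : ℝ}
    (hθ : θ ∈ Ioo (0 : ℝ) 1) {φ : ℝ → ℝ≥0∞} (hφ : Antitone φ)
    (h : varModular q dtOverT (fun t => ENNReal.ofReal (t ^ (1 - θ)) * φ t) ≤ 1) {t : ℝ}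
    (ht : 0 < t) : ENNReal.ofReal (t ^ (1 - θ)) * φ t ≤ 4 := by
  by_contra! hlt
  set x := ENNReal.ofReal (t ^ (1 - θ)) * φ t with hx
  have h2 : (1 : ℝ≥0∞) ≤ x / 2 := by
    rw [ENNReal.le_div_iff_mul_le (by simp) (by simp), one_mul]
    refine le_trans ?_ hlt.le
    norm_num
  have hlow : ∀ s ∈ Ioc (t / 2) t, x / 2 ≤ (ENNReal.ofReal (s ^ (1 - θ)) * φ s) ^ q s := by
    intro s hs
    have hs0 : 0 < s := lt_trans (by positivity) hs.1
    have h3 : x / 2 ≤ ENNReal.ofReal (s ^ (1 - θ)) * φ s := by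
      rw [hx, ENNReal.div_eq_inv_mul, ← mul_assoc]
      refine mul_le_mul' ?_ (hφ hs.2)
      have h2' : (2 : ℝ≥0∞)⁻¹ = ENNReal.ofReal (2⁻¹) := by
        rw [ENNReal.ofReal_inv_of_pos two_pos]
        simp
      rw [h2', ← ENNReal.ofReal_mul (by positivity)]
      refine ENNReal.ofReal_le_ofReal ?_
      calc 2⁻¹ * t ^ (1 - θ) ≤ (2⁻¹ : ℝ) ^ (1 - θ) * t ^ (1 - θ) := by
            gcongr
            exact Real.self_le_rpow_of_le_one (by norm_num) (by norm_num) (by linarith [hθ.1])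
        _ = (2⁻¹ * t) ^ (1 - θ) := (Real.mul_rpow (by norm_num) ht.le).symm
        _ ≤ s ^ (1 - θ) := by
            refine Real.rpow_le_rpow (by positivity) ?_ (by linarith [hθ.2])
            linarith [hs.1]
    calc x / 2 = (x / 2) ^ (1 : ℝ) := (ENNReal.rpow_one _).symm
      _ ≤ (x / 2) ^ q s := ENNReal.rpow_le_rpow_of_exponent_le h2 (hq s)
      _ ≤ _ := ENNReal.rpow_le_rpow h3 (zero_le_one.trans (hq s))
  have h4 : x / 4 ≤ 1 := by
    refine le_trans ?_ h
    rw [varModular, lintegral_dtOverT]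
    calc x / 4 = ∫⁻ _ in Ioc (t / 2) t, ENNReal.ofReal t⁻¹ * (x / 2) := by
          rw [setLIntegral_const, Real.volume_Ioc, mul_right_comm,
            ← ENNReal.ofReal_mul (by positivity)]
          have : t⁻¹ * (t - t / 2) = 2⁻¹ := by
            field_simp
            norm_num
          have h4 : (2 * 2 : ℝ≥0∞) = 4 := by norm_num
          rw [this, ENNReal.ofReal_inv_of_pos two_pos, ENNReal.div_eq_inv_mul,
            ENNReal.div_eq_inv_mul, ← mul_assoc _ _ x, ENNReal.ofReal_ofNat,
            ← ENNReal.mul_inv (by simp) (by simp), h4]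
      _ ≤ ∫⁻ s in Ioc (t / 2) t, ENNReal.ofReal s⁻¹ *
            (ENNReal.ofReal (s ^ (1 - θ)) * φ s) ^ q s := by
          refine setLIntegral_mono' measurableSet_Ioc fun s hs => ?_
          refine mul_le_mul' (ENNReal.ofReal_le_ofReal ?_) (hlow s hs)
          have hs0 : 0 < s := lt_trans (by positivity) hs.1
          exact inv_anti₀ hs0 hs.2
      _ ≤ _ := lintegral_mono_set fun s hs => lt_trans (by positivity : 0 < t / 2) hs.1
  rw [ENNReal.div_le_iff (by simp) (by simp), one_mul] at h4
  exact absurd h4 hlt.not_ge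

/-- The powers `s^{θ-1}` and `s^{1-θ}` cancel, leaving the plain integral that bounds the
`K`-functional. -/
theorem hardyAverage_rpow_mul {θ t : ℝ} (hθ : 0 < θ) (ht : 0 < t) (φ : ℝ → ℝ≥0∞)
    {a : ℝ≥0} (ha : a ≠ 0) :
    hardyAverage θ (fun s => ENNReal.ofReal (s ^ (1 - θ)) * φ s / a) t =
      ENNReal.ofReal θ / a * (ENNReal.ofReal (t ^ (-θ)) * ∫⁻ s in Ioc 0 t, φ s) := by
  have hat : (a : ℝ≥0∞)⁻¹ ≠ ∞ := ENNReal.inv_ne_top.2 (by simpa using ha)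
  rw [← mul_assoc, ← lintegral_const_mul' _ _ (by finiteness), hardyAverage]
  refine setLIntegral_congr_fun measurableSet_Ioc fun s hs => ?_
  have hs0 : 0 < s := hs.1
  have h1 : s ^ (θ - 1) * s ^ (1 - θ) = 1 := by
    rw [← Real.rpow_add hs0, sub_add_sub_cancel, sub_self, Real.rpow_zero]
  simp only [ENNReal.div_eq_inv_mul]
  calc _ = (a : ℝ≥0∞)⁻¹ * (ENNReal.ofReal (θ * t ^ (-θ) * s ^ (θ - 1)) *
        ENNReal.ofReal (s ^ (1 - θ))) * φ s := by ring
    _ = _ := by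
      rw [← ENNReal.ofReal_mul (by positivity), mul_assoc (θ * t ^ (-θ)), h1, mul_one,
        ENNReal.ofReal_mul hθ.le]
      ring

/-- Hardy's inequality in `L^{q(·)}((0, ∞), dt/t)` for non-increasing functions. -/
theorem exists_varModular_hardy_le_one {q : ℝ → ℝ} (hq : ∀ t, 1 ≤ q t) {c : ℝ}
    (hqc : ∀ t, 0 < t → |q t - q 0| * Real.log (min t t⁻¹)⁻¹ ≤ c) {θ : ℝ}
    (hθ : θ ∈ Ioo (0 : ℝ) 1) :
    ∃ C : ℝ≥0, 0 < C ∧ ∀ φ : ℝ → ℝ≥0∞, Antitone φ →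
      varModular q dtOverT (fun t => ENNReal.ofReal (t ^ (1 - θ)) * φ t) ≤ 1 →
      varModular q dtOverT
        (fun t => ENNReal.ofReal (t ^ (-θ)) * (∫⁻ s in Ioc 0 t, φ s) / C) ≤ 1 := by
  set A := ∫⁻ t, ENNReal.ofReal (min t t⁻¹) ∂dtOverT with hA
  set e := ENNReal.ofReal (Real.exp c) with he
  have hAt : A ≠ ∞ := lintegral_min_inv_dtOverT_lt_top.ne
  have hBt : e * (e + A) + A ≠ ∞ := by finiteness
  set B : ℝ≥0 := max 1 (e * (e + A) + A).toNNReal with hB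
  have hθ' : 0 < θ.toNNReal := Real.toNNReal_pos.2 hθ.1
  have hB1 : 1 ≤ B := le_max_left _ _
  have hB0 : 0 < B := zero_lt_one.trans_le hB1
  -- The 4 brings `g` below 1, `1/θ` undoes the normalisation of the average, and `B` absorbs the
  -- factors `e` and errors `A` of the two changes of exponent.
  refine ⟨B * (4 / θ.toNNReal), by positivity, fun φ hφ h => ?_⟩
  set g : ℝ → ℝ≥0∞ := fun s => ENNReal.ofReal (s ^ (1 - θ)) * φ s / (4 : ℝ≥0) with hg
  have hgm : Measurable g := by
    have := hφ.measurable
    fun_prop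
  have hg1 : ∀ s, 0 < s → g s ≤ 1 := fun s hs =>
    ENNReal.div_le_of_le_mul (by
      simpa using rpow_mul_le_four_of_varModular_le_one hq hθ hφ h hs)
  have hgq : varModular q dtOverT g ≤ 1 := by
    refine le_trans (varModular_mono hq fun t _ => ?_) h
    refine ENNReal.div_le_of_le_mul (le_mul_of_one_le_right' ?_)
    norm_num
  have hqc' : ∀ t, 0 < t → |q 0 - q t| * Real.log (min t t⁻¹)⁻¹ ≤ c := fun t ht => by
    rw [abs_sub_comm]
    exact hqc t ht
  have h0 : varModular (fun _ => q 0) dtOverT g ≤ e + A :=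
    (varModular_le_of_forall_rpow_le (a := fun _ => q 0) (b := q) (fun _ => hq 0) hqc' hg1).trans
      (add_le_add_left (mul_le_of_le_one_right' hgq) _)
  have h1 : varModular (fun _ => q 0) dtOverT (hardyAverage θ g) ≤ e + A :=
    (lintegral_hardyAverage_rpow_le hθ.1 (hq 0) hgm).trans h0
  have h2 : varModular q dtOverT (hardyAverage θ g) ≤ B := by
    refine (varModular_le_of_forall_rpow_le (a := q) (b := fun _ => q 0) hq hqc
      fun t ht => hardyAverage_le_one hθ.1 ht hg1).trans ?_
    calc e * varModular (fun _ => q 0) dtOverT (hardyAverage θ g) + A ≤ e * (e + A) + A := by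
          gcongr
      _ = ((e * (e + A) + A).toNNReal : ℝ≥0∞) := (ENNReal.coe_toNNReal hBt).symm
      _ ≤ B := ENNReal.coe_le_coe.2 (le_max_right _ _)
  calc _ ≤ varModular q dtOverT (fun t => hardyAverage θ g t / B) := by
        refine varModular_mono hq fun t ht => le_of_eq ?_
        rw [hg, hardyAverage_rpow_mul hθ.1 ht φ four_ne_zero]
        have e1 : ENNReal.ofReal θ = (θ.toNNReal : ℝ≥0∞) := rfl
        have e2 : ((B * (4 / θ.toNNReal) : ℝ≥0) : ℝ≥0∞)⁻¹ =
            ((θ.toNNReal / 4 * B⁻¹ : ℝ≥0) : ℝ≥0∞) := by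
          rw [← ENNReal.coe_inv (by positivity)]
          congr 1
          field_simp
        rw [ENNReal.div_eq_inv_mul, e2, ENNReal.div_eq_inv_mul, e1,
          ← ENNReal.coe_inv hB0.ne', ← ENNReal.coe_div (by norm_num),
          ← mul_assoc ((B⁻¹ : ℝ≥0) : ℝ≥0∞), ← ENNReal.coe_mul, mul_comm B⁻¹]
    _ ≤ varModular q dtOverT (hardyAverage θ g) / B := varModular_div_le hq _ hB1 _
    _ ≤ 1 := ENNReal.div_le_of_le_mul (by simpa using h2)

/-! ### The `K`-functional of `(L¹, L^∞)` -/

theorem antitone_rearrangement {n : ℕ} {𝕜 : Type*} [RCLike 𝕜]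
    (f : EuclideanSpace ℝ (Fin n) → 𝕜) : Antitone (rearrangement f) := fun _ _ h =>
  iSup₂_mono' fun s hs => ⟨s, ⟨hs.1, (ENNReal.ofReal_le_ofReal h).trans_lt hs.2⟩, le_rfl⟩

/-- Where `|f| > s`, almost everywhere `|f₀| ≥ s - ‖f₁‖_∞`. For `s` below `f^*(t)` this set has
measure at least `t`, so Markov's inequality gives `t (s - ‖f₁‖_∞) ≤ ‖f₀‖₁`. -/
theorem mul_rearrangement_le_K {n : ℕ} {𝕜 : Type*} [RCLike 𝕜] (t : ℝ)
    (f : EuclideanSpace ℝ (Fin n) →ₘ[volume] 𝕜) :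
    ENNReal.ofReal t * rearrangement f t ≤ (coupleL1LInfty n 𝕜).K t f := by
  refine le_iInf fun f₀ => le_iInf fun f₁ => le_iInf fun hf => ?_
  simp only [rearrangement, ENNReal.mul_iSup]
  refine iSup₂_le fun s hs => ?_
  have hf₁ : ∀ᵐ x, ‖f₁ x‖ₑ ≤ ‖f₁‖ₑ := by
    rw [Lp.enorm_def, eLpNorm_exponent_top]
    exact ae_le_eLpNormEssSup
  have hfx : ∀ᵐ x, f x = f₀ x + f₁ x := by
    rw [hf]
    exact AEEqFun.coeFn_add _ _
  have hmeas : ENNReal.ofReal t ≤ volume {x | (s : ℝ≥0∞) - ‖f₁‖ₑ ≤ ‖f₀ x‖ₑ} := by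
    refine hs.2.le.trans (measure_mono_ae ?_)
    filter_upwards [hf₁, hfx] with x h1 h2 hx
    have hx : s < ‖f x‖₊ := hx
    refine tsub_le_iff_right.2 ?_
    calc (s : ℝ≥0∞) ≤ ‖f x‖ₑ := ENNReal.coe_le_coe.2 hx.le
      _ ≤ ‖f₀ x‖ₑ + ‖f₁ x‖ₑ := by
        rw [h2]
        exact enorm_add_le _ _
      _ ≤ _ := by gcongr
  have hmarkov : ((s : ℝ≥0∞) - ‖f₁‖ₑ) * ENNReal.ofReal t ≤ ‖f₀‖ₑ := by
    rw [Lp.enorm_def f₀, eLpNorm_one_eq_lintegral_enorm]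
    refine le_trans ?_ (mul_meas_ge_le_lintegral₀ (Lp.aestronglyMeasurable f₀).enorm (s - ‖f₁‖ₑ))
    gcongr
  calc ENNReal.ofReal t * s ≤ ENNReal.ofReal t * ((s - ‖f₁‖ₑ) + ‖f₁‖ₑ) := by
        gcongr
        exact le_tsub_add
    _ ≤ _ := by
        rw [mul_add, mul_comm (ENNReal.ofReal t)]
        gcongr

theorem distribFun_le_of_rearrangement_le {n : ℕ} {𝕜 : Type*} [RCLike 𝕜]
    {f : EuclideanSpace ℝ (Fin n) → 𝕜} {t : ℝ} {s : ℝ≥0} (h : rearrangement f t ≤ s) :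
    distribFun f s ≤ ENNReal.ofReal t := by
  -- Right-continuity of the distribution function: levels strictly above `f^*(t)` obey the bound by
  -- definition, and it passes to the limit.
  have hU : {x | s < ‖f x‖₊} = ⋃ k : ℕ, {x | s + 1 / ((k : ℝ≥0) + 1) < ‖f x‖₊} := by
    ext x
    simp only [mem_ofPred_eq, mem_iUnion]
    refine ⟨fun hx => ?_, fun ⟨k, hk⟩ => le_self_add.trans_lt hk⟩
    obtain ⟨k, hk⟩ := exists_nat_one_div_lt (tsub_pos_of_lt hx)
    exact ⟨k, lt_tsub_iff_left.1 hk⟩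
  have hmono : Monotone fun k : ℕ => {x | s + 1 / ((k : ℝ≥0) + 1) < ‖f x‖₊} := by
    intro k l hkl x hx
    have hx : s + 1 / ((k : ℝ≥0) + 1) < ‖f x‖₊ := hx
    have hlk : s + 1 / ((l : ℝ≥0) + 1) ≤ s + 1 / ((k : ℝ≥0) + 1) := by gcongr
    exact hlk.trans_lt hx
  rw [distribFun, hU, hmono.measure_iUnion]
  refine iSup_le fun k => ?_
  by_contra! hk
  have hpos : 0 < 1 / ((k : ℝ≥0) + 1) := by positivity
  have h2 : ((s + 1 / ((k : ℝ≥0) + 1) : ℝ≥0) : ℝ≥0∞) ≤ s :=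
    (le_iSup₂_of_le _ ⟨by positivity, hk⟩ le_rfl).trans h
  exact absurd (ENNReal.coe_le_coe.1 h2) (lt_add_of_pos_right s hpos).not_ge

/-- By the layer-cake formula the left side is at most `∫ min(t, m_f(s)) ds`, the area of the part
of `{u < m_f(s)}` with `0 < u ≤ t`. Slicing that region the other way gives sections of length at
most `f^*(u)`. -/
theorem setLIntegral_enorm_le_lintegral_rearrangement {n : ℕ} {𝕜 : Type*} [RCLike 𝕜]
    {f : EuclideanSpace ℝ (Fin n) → 𝕜} (hf : Measurable f) {t : ℝ}
    {E : Set (EuclideanSpace ℝ (Fin n))} (hEt : volume E ≤ ENNReal.ofReal t) :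
    ∫⁻ x in E, ‖f x‖ₑ ≤ ∫⁻ u in Ioc 0 t, rearrangement f u := by
  set m : ℝ → ℝ≥0∞ := fun s => volume {x | s < ‖f x‖} with hm
  have hma : Antitone m := fun a b hab => measure_mono fun x hx => lt_of_le_of_lt hab hx
  let S : Set (ℝ × ℝ) := {z | ENNReal.ofReal z.2 < m z.1}
  have hS : MeasurableSet S := measurableSet_lt
    (ENNReal.measurable_ofReal.comp measurable_snd) (hma.measurable.comp measurable_fst)
  let k : ℝ → ℝ → ℝ≥0∞ := fun s u => S.indicator 1 (s, u)
  have hk : Measurable (Function.uncurry k) := measurable_one.indicator hS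
  have hlow : ∀ s : ℝ, volume.restrict E {x | s < ‖f x‖} ≤ ∫⁻ u in Ioc 0 t, k s u := by
    intro s
    set d := min (ENNReal.ofReal t) (m s) with hd
    have hdt : d ≠ ∞ := ((min_le_left _ _).trans_lt ENNReal.ofReal_lt_top).ne
    calc volume.restrict E {x | s < ‖f x‖} ≤ d := by
          refine le_min ?_ (Measure.restrict_apply_le _ _)
          exact (measure_mono (subset_univ _)).trans (by simpa using hEt)
      _ = ∫⁻ u in Ioo 0 d.toReal, 1 := by simp [ENNReal.ofReal_toReal hdt]
      _ ≤ ∫⁻ u in Ioo 0 d.toReal, k s u := by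
          refine setLIntegral_mono' measurableSet_Ioo fun u hu => ?_
          have : (s, u) ∈ S :=
            ((ENNReal.ofReal_lt_iff_lt_toReal hu.1.le hdt).2 hu.2).trans_le (min_le_right _ _)
          simp [k, this]
      _ ≤ _ := by
          refine lintegral_mono_set fun u hu => ⟨hu.1, ?_⟩
          have h1 : ENNReal.ofReal u < ENNReal.ofReal t :=
            ((ENNReal.ofReal_lt_iff_lt_toReal hu.1.le hdt).2 hu.2).trans_le (min_le_left _ _)
          exact (lt_of_not_ge fun h => h1.not_ge (ENNReal.ofReal_le_ofReal h)).le
  have hup : ∀ u : ℝ, ∫⁻ s in Ioi (0 : ℝ), k s u ≤ rearrangement f u := by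
    intro u
    rcases eq_or_ne (rearrangement f u) ∞ with h | h
    · simp [h]
    calc ∫⁻ s in Ioi (0 : ℝ), k s u
        ≤ ∫⁻ s, (Ioc 0 (rearrangement f u).toReal).indicator 1 s := by
          rw [← lintegral_indicator measurableSet_Ioi]
          refine lintegral_mono fun s => ?_
          by_cases hs : 0 < s ∧ ENNReal.ofReal u < m s
          · have hmem : s ∈ Ioc 0 (rearrangement f u).toReal := by
              refine ⟨hs.1, (ENNReal.ofReal_le_iff_le_toReal h).1 ?_⟩
              refine le_iSup₂_of_le s.toNNReal ⟨Real.toNNReal_pos.2 hs.1, hs.2.trans_le ?_⟩ le_rfl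
              refine measure_mono fun x hx => ?_
              have hx : s < ‖f x‖ := hx
              exact (Real.toNNReal_lt_iff_lt_coe hs.1.le).2 hx
            rw [indicator_of_mem hmem, indicator_of_mem (mem_Ioi.2 hs.1)]
            exact indicator_le_self _ _ _
          · refine le_of_eq_of_le ?_ bot_le
            by_cases h0 : 0 < s
            · have : (s, u) ∉ S := fun h => hs ⟨h0, h⟩
              simp [k, this]
            · simp [h0]
      _ = rearrangement f u := by
          rw [lintegral_indicator_one measurableSet_Ioc, Real.volume_Ioc, sub_zero,
            ENNReal.ofReal_toReal h]
  calc ∫⁻ x in E, ‖f x‖ₑ = ∫⁻ s in Ioi (0 : ℝ), volume.restrict E {x | s < ‖f x‖} := by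
        rw [← lintegral_eq_lintegral_meas_lt _ (Filter.Eventually.of_forall fun x => norm_nonneg _)
          hf.norm.aemeasurable]
        simp only [ofReal_norm]
    _ ≤ ∫⁻ s in Ioi (0 : ℝ), ∫⁻ u in Ioc 0 t, k s u := lintegral_mono hlow
    _ = ∫⁻ u in Ioc 0 t, ∫⁻ s in Ioi (0 : ℝ), k s u := lintegral_lintegral_swap hk.aemeasurable
    _ ≤ _ := lintegral_mono hup

/-- Cut `f` at height `f^*(t)`. The part above lives on a set of measure at most `t`, so its `L¹`
norm is at most the integral; the part below contributes at most `t f^*(t)`, again at most the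
integral by monotonicity. -/
theorem K_le_two_mul_lintegral_rearrangement {n : ℕ} {𝕜 : Type*} [RCLike 𝕜] {t : ℝ} (ht : 0 < t)
    (f : EuclideanSpace ℝ (Fin n) →ₘ[volume] 𝕜) :
    (coupleL1LInfty n 𝕜).K t f ≤ 2 * ∫⁻ u in Ioc 0 t, rearrangement f u := by
  set I := ∫⁻ u in Ioc 0 t, rearrangement f u with hI
  rcases eq_or_ne I ∞ with hIt | hIt
  · simp [hIt]
  have htI : ENNReal.ofReal t * rearrangement f t ≤ I := by
    calc _ = ∫⁻ u in Ioc 0 t, rearrangement f t := by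
          rw [setLIntegral_const, Real.volume_Ioc, sub_zero, mul_comm]
      _ ≤ I := setLIntegral_mono' measurableSet_Ioc fun u hu => antitone_rearrangement _ hu.2
  -- A finite integral makes the cutting height finite.
  have hrt : rearrangement f t ≠ ∞ := by
    intro h
    rw [h, ENNReal.mul_top (by simpa using ht)] at htI
    exact hIt (top_le_iff.1 htI)
  set s := (rearrangement f t).toNNReal with hs
  have hsr : (s : ℝ≥0∞) = rearrangement f t := ENNReal.coe_toNNReal hrt
  have hfm : Measurable f := f.measurable
  set E := {x | s < ‖f x‖₊} with hEdef
  have hE : MeasurableSet E := measurableSet_lt measurable_const hfm.nnnorm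
  have hEI : ∫⁻ x in E, ‖f x‖ₑ ≤ I := setLIntegral_enorm_le_lintegral_rearrangement hfm
    (distribFun_le_of_rearrangement_le hsr.ge)
  have hn₀ : eLpNorm (E.indicator f) 1 volume ≤ I := by
    rw [eLpNorm_one_eq_lintegral_enorm]
    simpa only [enorm_indicator_eq_indicator_enorm, lintegral_indicator hE] using hEI
  have hb₁ : ∀ x, ‖Eᶜ.indicator f x‖ₑ ≤ s := by
    intro x
    by_cases hx : x ∈ E
    · simp [hx]
    · rw [indicator_of_mem (mem_compl hx)]
      exact ENNReal.coe_le_coe.2 (not_lt.1 hx)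
  have hn₁ : eLpNorm (Eᶜ.indicator f) ∞ volume ≤ s := by
    rw [eLpNorm_exponent_top]
    exact eLpNormEssSup_le_of_ae_enorm_bound (Filter.Eventually.of_forall hb₁)
  have hf₀ : MemLp (E.indicator f) 1 volume :=
    ⟨(hfm.indicator hE).aestronglyMeasurable, hn₀.trans_lt hIt.lt_top⟩
  have hf₁ : MemLp (Eᶜ.indicator f) ∞ volume :=
    ⟨(hfm.indicator hE.compl).aestronglyMeasurable, hn₁.trans_lt ENNReal.coe_lt_top⟩
  have hdec : f = (coupleL1LInfty n 𝕜).ι₀ hf₀.toLp + (coupleL1LInfty n 𝕜).ι₁ hf₁.toLp := by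
    refine AEEqFun.ext ?_
    have h1 : ((coupleL1LInfty n 𝕜).ι₀ hf₀.toLp : EuclideanSpace ℝ (Fin n) → 𝕜) =ᵐ[volume]
      E.indicator f := hf₀.coeFn_toLp
    have h2 : ((coupleL1LInfty n 𝕜).ι₁ hf₁.toLp : EuclideanSpace ℝ (Fin n) → 𝕜) =ᵐ[volume]
      Eᶜ.indicator f := hf₁.coeFn_toLp
    filter_upwards [h1, h2, AEEqFun.coeFn_add ((coupleL1LInfty n 𝕜).ι₀ hf₀.toLp)
      ((coupleL1LInfty n 𝕜).ι₁ hf₁.toLp)] with x h1 h2 h3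
    rw [h3, Pi.add_apply, h1, h2, ← Pi.add_apply, indicator_self_add_compl]
  calc (coupleL1LInfty n 𝕜).K t f ≤ ‖hf₀.toLp‖ₑ + ENNReal.ofReal t * ‖hf₁.toLp‖ₑ :=
        iInf₂_le_of_le _ _ (iInf_le _ hdec)
    _ ≤ I + ENNReal.ofReal t * rearrangement f t := by
        rw [Lp.enorm_toLp, Lp.enorm_toLp, ← hsr]
        gcongr
    _ ≤ I + I := by gcongr
    _ = 2 * I := (two_mul I).symm

/-! ### The two norm inequalities and the theorem -/

theorem exists_abs_mul_log_inv_min_le {q : ℝ → ℝ} {qInf : ℝ} (hq0 : LogHolderAtZero q)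
    (hqInf : LogHolderAtInfty q qInf) (h_eq : q 0 = qInf) :
    ∃ c, ∀ t, 0 < t → |q t - q 0| * Real.log (min t t⁻¹)⁻¹ ≤ c := by
  obtain ⟨c₀, -, h₀⟩ := hq0
  obtain ⟨c₁, -, h₁⟩ := hqInf
  have hlog : ∀ s : ℝ, 0 ≤ s → 0 ≤ Real.log (Real.exp 1 + s) := fun s hs =>
    Real.log_nonneg (by linarith [Real.add_one_le_exp (1 : ℝ)])
  refine ⟨max c₀ c₁, fun t ht => abs_mul_log_inv_min_le ht ((h₀ t).trans ?_) ?_⟩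
  · exact div_le_div_of_nonneg_right (le_max_left _ _) (hlog _ (by positivity))
  · rw [h_eq]
    exact (h₁ t).trans (div_le_div_of_nonneg_right (le_max_right _ _) (hlog _ (abs_nonneg t)))

theorem lorentzNorm_eq_luxemburgNorm_dtOverT {n : ℕ} {𝕜 : Type*} [RCLike 𝕜] {q : ℝ → ℝ}
    (hq : ∀ t, 1 ≤ q t) (θ : ℝ) (f : EuclideanSpace ℝ (Fin n) → 𝕜) :
    lorentzNorm (fun _ => 1 / (1 - θ)) q f =
      luxemburgNorm q dtOverT fun t => ENNReal.ofReal (t ^ (1 - θ)) * rearrangement f t := by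
  have h : ∀ r : ℝ≥0, varModular q (volume.restrict (Ici (0 : ℝ)))
      (fun t => ENNReal.ofReal (t ^ (1 / (1 / (1 - θ)) - 1 / q t)) * rearrangement f t / r) =
      varModular q dtOverT fun t => ENNReal.ofReal (t ^ (1 - θ)) * rearrangement f t / r := by
    intro r
    rw [varModular, varModular, lintegral_dtOverT, ← setLIntegral_congr Ioi_ae_eq_Ici]
    refine setLIntegral_congr_fun measurableSet_Ioi fun t ht => ?_
    have ht : 0 < t := ht
    have hqt : 0 < q t := zero_lt_one.trans_le (hq t)
    -- The density of `dt/t` is the `q(t)`-th power of the factor `t^{-1/q(t)}` in the Lorentz norm.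
    have h1 : ENNReal.ofReal t⁻¹ = ENNReal.ofReal (t ^ (-(1 / q t))) ^ q t := by
      rw [ENNReal.ofReal_rpow_of_pos (by positivity), ← Real.rpow_mul ht.le, neg_mul,
        one_div_mul_cancel hqt.ne', Real.rpow_neg_one]
    rw [h1, ← ENNReal.mul_rpow_of_nonneg _ _ hqt.le, one_div_one_div, sub_eq_add_neg,
      Real.rpow_add ht, ENNReal.ofReal_mul (by positivity)]
    simp only [ENNReal.div_eq_inv_mul]
    congr 1
    ring
  simp only [lorentzNorm, luxemburgNorm, h]

theorem lorentzNorm_le_interpNorm {n : ℕ} {𝕜 : Type*} [RCLike 𝕜] {q : ℝ → ℝ}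
    (hq : ∀ t, 1 ≤ q t) (θ : ℝ) (f : EuclideanSpace ℝ (Fin n) →ₘ[volume] 𝕜) :
    lorentzNorm (fun _ => 1 / (1 - θ)) q f ≤ (coupleL1LInfty n 𝕜).interpNorm θ q f := by
  rw [lorentzNorm_eq_luxemburgNorm_dtOverT hq, CompatibleCouple.interpNorm]
  refine le_of_le_of_eq (luxemburgNorm_le_mul (C := 1) one_pos fun r hr h =>
    le_trans (varModular_mono hq fun t ht => ?_) h) (by rw [ENNReal.coe_one, one_mul])
  rw [one_mul]
  refine ENNReal.div_le_div_right ?_ _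
  calc ENNReal.ofReal (t ^ (1 - θ)) * rearrangement f t
      = ENNReal.ofReal (t ^ (-θ)) * (ENNReal.ofReal t * rearrangement f t) := by
        rw [← mul_assoc, ← ENNReal.ofReal_mul (by positivity), sub_eq_neg_add,
          Real.rpow_add ht, Real.rpow_one]
    _ ≤ _ := by
        gcongr
        exact mul_rearrangement_le_K t f

theorem exists_interpNorm_le_mul_lorentzNorm {q : ℝ → ℝ} (hq : ∀ t, 1 ≤ q t) {c : ℝ}
    (hqc : ∀ t, 0 < t → |q t - q 0| * Real.log (min t t⁻¹)⁻¹ ≤ c) {θ : ℝ}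
    (hθ : θ ∈ Ioo (0 : ℝ) 1) (n : ℕ) (𝕜 : Type*) [RCLike 𝕜] :
    ∃ C : ℝ≥0, 0 < C ∧ ∀ f : EuclideanSpace ℝ (Fin n) →ₘ[volume] 𝕜,
      (coupleL1LInfty n 𝕜).interpNorm θ q f ≤ C * lorentzNorm (fun _ => 1 / (1 - θ)) q f := by
  obtain ⟨C, hC, h⟩ := exists_varModular_hardy_le_one hq hqc hθ
  -- The 2 comes from the upper bound for `K`, and `C` from Hardy's inequality, applied to `f^* /
  -- r`.
  refine ⟨2 * C, by positivity, fun f => ?_⟩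
  rw [lorentzNorm_eq_luxemburgNorm_dtOverT hq, CompatibleCouple.interpNorm]
  refine luxemburgNorm_le_mul (by positivity) fun r hr hr1 => ?_
  have hr0 : (r : ℝ≥0∞) ≠ 0 := by simpa using hr.ne'
  have hφ : Antitone fun t => rearrangement f t / r := fun a b hab =>
    ENNReal.div_le_div_right (antitone_rearrangement _ hab) _
  simp only [mul_div_assoc] at hr1
  refine le_trans (varModular_mono hq fun t ht => ?_) (h _ hφ hr1)
  simp only [ENNReal.div_eq_inv_mul]
  rw [lintegral_const_mul' _ _ (ENNReal.inv_ne_top.2 hr0)]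
  have h2 : ((2 * C * r : ℝ≥0) : ℝ≥0∞)⁻¹ = (C : ℝ≥0∞)⁻¹ * (r : ℝ≥0∞)⁻¹ * 2⁻¹ := by
    have hC0 : (C : ℝ≥0∞) ≠ 0 := by simpa using hC.ne'
    rw [ENNReal.coe_mul, ENNReal.coe_mul,
      ENNReal.mul_inv (Or.inr ENNReal.coe_ne_top) (Or.inr hr0),
      ENNReal.mul_inv (by simp) (by simp), ENNReal.coe_ofNat]
    ring
  calc ((2 * C * r : ℝ≥0) : ℝ≥0∞)⁻¹ *
        (ENNReal.ofReal (t ^ (-θ)) * (coupleL1LInfty n 𝕜).K t f)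
      ≤ ((2 * C * r : ℝ≥0) : ℝ≥0∞)⁻¹ *
        (ENNReal.ofReal (t ^ (-θ)) * (2 * ∫⁻ u in Ioc 0 t, rearrangement f u)) := by
        gcongr
        exact K_le_two_mul_lintegral_rearrangement ht f
    _ = 2⁻¹ * 2 * ((C : ℝ≥0∞)⁻¹ * (ENNReal.ofReal (t ^ (-θ)) *
        ((r : ℝ≥0∞)⁻¹ * ∫⁻ u in Ioc 0 t, rearrangement f u))) := by
        rw [h2]
        ring
    _ = _ := by rw [ENNReal.inv_mul_cancel (by simp) (by simp), one_mul]

theorem dtOverT_ne_zero : dtOverT ≠ 0 := by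
  intro h
  have h1 := lintegral_dtOverT fun t => ENNReal.ofReal t
  rw [h, lintegral_zero_measure] at h1
  have h2 : ∫⁻ t in Ioi (0 : ℝ), ENNReal.ofReal t⁻¹ * ENNReal.ofReal t =
      ∫⁻ _ in Ioi (0 : ℝ), 1 := by
    refine setLIntegral_congr_fun measurableSet_Ioi fun t ht => ?_
    have ht : 0 < t := ht
    rw [← ENNReal.ofReal_mul (by positivity), inv_mul_cancel₀ ht.ne', ENNReal.ofReal_one]
  rw [h2] at h1
  simp at h1

/-- Outside the sum `K` is identically `∞`, so the modular is infinite for every `r`, as `dt/t` is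
not the zero measure. Hence the upper norm inequality alone puts the Lorentz space inside `L¹ +
L^∞`. -/
theorem CompatibleCouple.mem_sum_of_interpNorm_lt_top {𝕜 A₀ A₁ Z : Type*} [RCLike 𝕜]
    [NormedAddCommGroup A₀] [NormedSpace 𝕜 A₀] [CompleteSpace A₀]
    [NormedAddCommGroup A₁] [NormedSpace 𝕜 A₁] [CompleteSpace A₁]
    [AddCommGroup Z] [Module 𝕜 Z] (A : CompatibleCouple 𝕜 A₀ A₁ Z) {θ : ℝ} {q : ℝ → ℝ}
    (hq : ∀ t, 1 ≤ q t) {f : Z} (hf : A.interpNorm θ q f < ∞) : f ∈ A.sum := by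
  by_contra hns
  have hK : ∀ t, A.K t f = ∞ := fun t => by
    simp only [CompatibleCouple.K, iInf_eq_top]
    exact fun f₀ f₁ h => absurd ⟨f₀, f₁, h⟩ hns
  simp only [CompatibleCouple.interpNorm, luxemburgNorm, iInf_lt_iff] at hf
  obtain ⟨r, ⟨hr, h⟩, -⟩ := hf
  have htop : varModular q dtOverT
      (fun t => ENNReal.ofReal (t ^ (-θ)) * A.K t f / r) = ∞ := by
    calc _ = ∫⁻ _, ∞ ∂dtOverT := by
          refine lintegral_congr_ae ?_
          filter_upwards [ae_dtOverT_pos] with t ht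
          have h1 : ENNReal.ofReal (t ^ (-θ)) ≠ 0 := by
            simpa using Real.rpow_pos_of_pos ht (-θ)
          rw [hK, ENNReal.mul_top h1, ENNReal.top_div_coe,
            ENNReal.top_rpow_of_pos (zero_lt_one.trans_le (hq t))]
      _ = ∞ := by
          rw [lintegral_const, ENNReal.top_mul]
          simpa using dtOverT_ne_zero
  rw [htop] at h
  exact absurd h (by simp)

theorem mainTheorem9 {𝕜 : Type*} [RCLike 𝕜] (n : ℕ) (θ : ℝ) (hθ : θ ∈ Set.Ioo (0 : ℝ) 1)
    (q : ℝ → ℝ) (qInf : ℝ) (hq : IsVariableExponent q) (hq0 : LogHolderAtZero q)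
    (hqInf : LogHolderAtInfty q qInf) (h_eq : q 0 = qInf) :
    (coupleL1LInfty n 𝕜).interpSpace θ q = lorentzSpace n 𝕜 (fun _ => 1 / (1 - θ)) q ∧
      ∃ c C : NNReal, 0 < c ∧ 0 < C ∧ ∀ f : EuclideanSpace ℝ (Fin n) →ₘ[volume] 𝕜,
        c * lorentzNorm (fun _ => 1 / (1 - θ)) q f ≤ (coupleL1LInfty n 𝕜).interpNorm θ q f ∧
        (coupleL1LInfty n 𝕜).interpNorm θ q f ≤ C * lorentzNorm (fun _ => 1 / (1 - θ)) q f := by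
  obtain ⟨c, hqc⟩ := exists_abs_mul_log_inv_min_le hq0 hqInf h_eq
  obtain ⟨C, hC, hupper⟩ := exists_interpNorm_le_mul_lorentzNorm hq.one_le hqc hθ n 𝕜
  have hlower := lorentzNorm_le_interpNorm (n := n) (𝕜 := 𝕜) hq.one_le θ
  refine ⟨Set.ext fun f => ⟨fun hf => (hlower f).trans_lt hf.2, fun hf => ?_⟩,
    1, C, one_pos, hC, fun f => ⟨by simpa using hlower f, hupper f⟩⟩
  have hfin : (coupleL1LInfty n 𝕜).interpNorm θ q f < ∞ :=
    (hupper f).trans_lt (ENNReal.mul_lt_top ENNReal.coe_lt_top hf)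
  exact ⟨CompatibleCouple.mem_sum_of_interpNorm_lt_top _ hq.one_le hfin, hfin⟩
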